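/- Let $n\in\mathbb N$, let $M_n=M_n(\mathbb C)$ be the algebra of complex $n\times n$ matrices, and let $\rho$ be a quasi-order (a reflexive and transitive relation) on $\{1,\dots,n\}$. Let $$\mathcal A_\rho=\{X\in M_n : X_{ij}\neq 0 \Rightarrow (i,j)\in\rho\}$$ be the structural matrix algebra defined by $\rho$, a unital subalgebra of $M_n$ with centre $Z(\mathcal A_\rho)$. (The algebras $\mathcal A_\rho$ are exactly the subalgebras of $M_n$ that contain all diagonal matrices.) A map $\phi:\mathcal A_\rho\to M_n$ is called a rank preserver if $\operatorname{rank}\phi(X)=\operatorname{rank}X$ for all $X\in\mathcal A_\rho$, and unital if $\phi(I)=I$. A map $g:\rho\to\mathbb C^\times$ is called transitive if $g(i,j)g(j,k)=g(i,k)$ for all $(i,j),(j,k)\in\rho$, and trivial if there is a map $s:\{1,\dots,n\}\to\mathbb C^\times$ with $g(i,j)=s(i)/s(j)$ for all $(i,j)\in\rho$. A transitive map $g$ induces an algebra automorphism $g^*$ of $\mathcal A_\rho$, the linear map with $g^*(E_{ij})=g(i,j)E_{ij}$ for all $(i,j)\in\rho$, where $E_{ij}$ are the matrix units. Then: 1.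 A map $\phi:\mathcal A_\rho\to M_n$ is a linear unital rank preserver if and only if there exist an invertible matrix $T\in M_n$ and a central idempotent $P\in Z(\mathcal A_\rho)$ such that $$\phi(X)=T\bigl(PX+(I-P)X^t\bigr)T^{-1}\qquad\text{for all }X\in\mathcal A_\rho .$$ 2. If $g:\rho\to\mathbb C^\times$ is a transitive map whose induced automorphism $g^*$ is a rank preserver, then $g$ is trivial. -/

import Mathlib

/-- The structural matrix algebra `A_ρ` defined by a quasi-order (reflexive and transitive
relation) `ρ` on `Fin n`: all complex `n × n` matrices supported in `ρ`. -/
def structuralMatrixAlgebra {n : ℕ} (ρ : Fin n → Fin n → Prop) [IsPreorder (Fin n) ρ] :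
    Subalgebra ℂ (Matrix (Fin n) (Fin n) ℂ) where
  carrier := {X | ∀ i j, X i j ≠ 0 → ρ i j}
  mul_mem' := by
    intro X Y hX hY i j hij
    rw [Matrix.mul_apply] at hij
    obtain ⟨k, -, hk⟩ := Finset.exists_ne_zero_of_sum_ne_zero hij
    exact _root_.trans (hX i k (left_ne_zero_of_mul hk)) (hY k j (right_ne_zero_of_mul hk))
  add_mem' := by
    intro X Y hX hY i j hij
    by_contra h
    have h1 : X i j = 0 := by_contra fun h1 => h (hX i j h1)
    have h2 : Y i j = 0 := by_contra fun h2 => h (hY i j h2)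
    exact hij (by simp [h1, h2])
  algebraMap_mem' := by
    intro c i j hij
    by_cases h : i = j
    · subst h
      exact refl_of ρ i
    · exact absurd (by simp [Matrix.algebraMap_matrix_apply, h]) hij

theorem mem_structuralMatrixAlgebra {n : ℕ} {ρ : Fin n → Fin n → Prop} [IsPreorder (Fin n) ρ]
    {X : Matrix (Fin n) (Fin n) ℂ} :
    X ∈ structuralMatrixAlgebra ρ ↔ ∀ i j, X i j ≠ 0 → ρ i j :=
  Iff.rfl

/-- A map `φ : A_ρ → M_n` is a rank preserver if `rank (φ X) = rank X` for all `X`. -/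
def IsRankPreserver {n : ℕ} {ρ : Fin n → Fin n → Prop} [IsPreorder (Fin n) ρ]
    (φ : structuralMatrixAlgebra ρ → Matrix (Fin n) (Fin n) ℂ) : Prop :=
  ∀ X : structuralMatrixAlgebra ρ, (φ X).rank = (X : Matrix (Fin n) (Fin n) ℂ).rank

/-- A map `g : ρ → ℂˣ` is transitive if `g(i,j) g(j,k) = g(i,k)` for all
`(i,j), (j,k) ∈ ρ`. -/
def IsTransitiveMap {n : ℕ} {ρ : Fin n → Fin n → Prop} [IsPreorder (Fin n) ρ]
    (g : {p : Fin n × Fin n // ρ p.1 p.2} → ℂˣ) : Prop :=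
  ∀ (i j k : Fin n) (hij : ρ i j) (hjk : ρ j k),
    g ⟨(i, j), hij⟩ * g ⟨(j, k), hjk⟩ = g ⟨(i, k), _root_.trans hij hjk⟩

/-- A map `g : ρ → ℂˣ` is trivial if `g(i,j) = s(i) / s(j)` on `ρ` for some
`s : Fin n → ℂˣ`. -/
def IsTrivialMap {n : ℕ} {ρ : Fin n → Fin n → Prop}
    (g : {p : Fin n × Fin n // ρ p.1 p.2} → ℂˣ) : Prop :=
  ∃ s : Fin n → ℂˣ, ∀ (i j : Fin n) (hij : ρ i j), g ⟨(i, j), hij⟩ = s i / s j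

open Classical in
/-- The matrix obtained from `X` by multiplying the entry `(i,j) ∈ ρ` by `g(i,j)` (and with
entry `0` outside `ρ`, where every member of `A_ρ` vanishes). -/
noncomputable def scaleEntries {n : ℕ} {ρ : Fin n → Fin n → Prop}
    (g : {p : Fin n × Fin n // ρ p.1 p.2} → ℂˣ) (X : Matrix (Fin n) (Fin n) ℂ) :
    Matrix (Fin n) (Fin n) ℂ :=
  Matrix.of fun i j => if h : ρ i j then (g ⟨(i, j), h⟩ : ℂ) * X i j else 0

theorem scaleEntries_apply_of_rel {n : ℕ} {ρ : Fin n → Fin n → Prop}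
    (g : {p : Fin n × Fin n // ρ p.1 p.2} → ℂˣ) (X : Matrix (Fin n) (Fin n) ℂ)
    {i j : Fin n} (h : ρ i j) : scaleEntries g X i j = (g ⟨(i, j), h⟩ : ℂ) * X i j := by
  simp [scaleEntries, h]

theorem scaleEntries_apply_of_not_rel {n : ℕ} {ρ : Fin n → Fin n → Prop}
    (g : {p : Fin n × Fin n // ρ p.1 p.2} → ℂˣ) (X : Matrix (Fin n) (Fin n) ℂ)
    {i j : Fin n} (h : ¬ ρ i j) : scaleEntries g X i j = 0 := by
  simp [scaleEntries, h]

theorem scaleEntries_mem {n : ℕ} {ρ : Fin n → Fin n → Prop} [IsPreorder (Fin n) ρ]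
    (g : {p : Fin n × Fin n // ρ p.1 p.2} → ℂˣ) (X : Matrix (Fin n) (Fin n) ℂ) :
    scaleEntries g X ∈ structuralMatrixAlgebra ρ := fun i j hij => by
  by_contra h
  exact hij (scaleEntries_apply_of_not_rel g X h)

theorem scaleEntries_mul {n : ℕ} {ρ : Fin n → Fin n → Prop} [IsPreorder (Fin n) ρ]
    {g : {p : Fin n × Fin n // ρ p.1 p.2} → ℂˣ} (hg : IsTransitiveMap g)
    {X Y : Matrix (Fin n) (Fin n) ℂ} (hX : X ∈ structuralMatrixAlgebra ρ)
    (hY : Y ∈ structuralMatrixAlgebra ρ) :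
    scaleEntries g (X * Y) = scaleEntries g X * scaleEntries g Y := by
  ext i k
  by_cases hik : ρ i k
  · rw [scaleEntries_apply_of_rel g _ hik, Matrix.mul_apply, Matrix.mul_apply, Finset.mul_sum]
    refine Finset.sum_congr rfl fun j _ => ?_
    by_cases hij : ρ i j
    · by_cases hjk : ρ j k
      · rw [scaleEntries_apply_of_rel g _ hij, scaleEntries_apply_of_rel g _ hjk,
          ← hg i j k hij hjk, Units.val_mul]
        ring
      · have h0 : Y j k = 0 := by_contra fun h => hjk (hY j k h)
        rw [scaleEntries_apply_of_not_rel g _ hjk, h0]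
        simp
    · have h0 : X i j = 0 := by_contra fun h => hij (hX i j h)
      rw [scaleEntries_apply_of_not_rel g _ hij, h0]
      simp
  · have h1 := fun h => hik (scaleEntries_mem g (X * Y) i k h)
    have h2 := fun h => hik ((structuralMatrixAlgebra ρ).mul_mem
      (scaleEntries_mem g X) (scaleEntries_mem g Y) i k h)
    rw [not_not.mp h1, not_not.mp h2]

theorem IsTransitiveMap.apply_diag {n : ℕ} {ρ : Fin n → Fin n → Prop} [IsPreorder (Fin n) ρ]
    {g : {p : Fin n × Fin n // ρ p.1 p.2} → ℂˣ} (hg : IsTransitiveMap g) (i : Fin n) :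
    g ⟨(i, i), refl_of ρ i⟩ = 1 := by
  have h := hg i i i (refl_of ρ i) (refl_of ρ i)
  simpa using h

/-- The algebra automorphism `g^*` of `A_ρ` induced by a transitive map `g`. -/
noncomputable def inducedAut {n : ℕ} {ρ : Fin n → Fin n → Prop} [IsPreorder (Fin n) ρ]
    (g : {p : Fin n × Fin n // ρ p.1 p.2} → ℂˣ) (hg : IsTransitiveMap g) :
    structuralMatrixAlgebra ρ ≃ₐ[ℂ] structuralMatrixAlgebra ρ where
  toFun X := ⟨scaleEntries g X.1, scaleEntries_mem g X.1⟩
  invFun X := ⟨scaleEntries (fun p => (g p)⁻¹) X.1, scaleEntries_mem _ X.1⟩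
  left_inv X := by
    ext i j
    by_cases h : ρ i j
    · simp [scaleEntries_apply_of_rel _ _ h]
    · have h0 : X.1 i j = 0 := by_contra fun h' => h (X.2 i j h')
      simp [scaleEntries_apply_of_not_rel _ _ h, h0]
  right_inv X := by
    ext i j
    by_cases h : ρ i j
    · simp [scaleEntries_apply_of_rel _ _ h]
    · have h0 : X.1 i j = 0 := by_contra fun h' => h (X.2 i j h')
      simp [scaleEntries_apply_of_not_rel _ _ h, h0]
  map_mul' X Y := Subtype.ext (scaleEntries_mul hg X.2 Y.2)
  map_add' X Y := by
    ext i j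
    by_cases h : ρ i j
    · simp [scaleEntries_apply_of_rel _ _ h, mul_add]
    · simp [scaleEntries_apply_of_not_rel _ _ h]
  commutes' c := by
    ext i j
    by_cases h : ρ i j
    · by_cases hij : i = j
      · subst hij
        simp [scaleEntries_apply_of_rel _ _ h, hg.apply_diag]
      · simp [scaleEntries_apply_of_rel _ _ h, Matrix.algebraMap_matrix_apply, hij]
    · have hij : i ≠ j := fun e => h (e ▸ refl_of ρ i)
      simp [scaleEntries_apply_of_not_rel _ _ h, Matrix.algebraMap_matrix_apply, hij]

/-- On matrix units, `g^* E_ij = g(i,j) E_ij` for `(i,j) ∈ ρ`. -/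
theorem inducedAut_single {n : ℕ} {ρ : Fin n → Fin n → Prop} [IsPreorder (Fin n) ρ]
    (g : {p : Fin n × Fin n // ρ p.1 p.2} → ℂˣ) (hg : IsTransitiveMap g)
    (i j : Fin n) (hij : ρ i j) (hE : Matrix.single i j (1 : ℂ) ∈ structuralMatrixAlgebra ρ) :
    (inducedAut g hg ⟨Matrix.single i j 1, hE⟩ : Matrix (Fin n) (Fin n) ℂ) =
      (g ⟨(i, j), hij⟩ : ℂ) • Matrix.single i j (1 : ℂ) := by
  ext k l
  change scaleEntries g (Matrix.single i j 1) k l = _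
  by_cases h : i = k ∧ j = l
  · obtain ⟨rfl, rfl⟩ := h
    simp [scaleEntries_apply_of_rel g _ hij]
  · simp [scaleEntries, Matrix.single_apply, h]

/-! The images of the `E_ii` have rank one and sum to `I`, so a similarity turns them back into the
`E_ii`. Vanishing 2×2 minors then force each `E_ij` with `i ≠ j` to go to a nonzero multiple of
`E_ij` (straight) or of `E_ji` (flipped). Transitivity of `ρ` makes this choice constant on
connected components of `ρ`, and the straight components give the central idempotent `P`.
Transposing the complementary block does not change rank (`Matrix.rank_partialTranspose`), so the
remaining scalars `g i j` form an entrywise multiplier preserving rank on matrices supported in `ρ`.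
The key lemma is `exists_eq_mul_of_rank_preserving`: such a multiplier has the form `a i * b j`.
Otherwise its deviation from that form would show on some cycle of the bipartite row-column graph,
and a matrix supported on a shortest cycle would change rank. As `g i i = 1`, `b = a⁻¹`, so the
scalars are absorbed into a diagonal conjugation. The same lemma gives the second claim directly. -/

/-! ### Entrywise multipliers that preserve rank -/

section HadamardWeights

variable {K m n : Type*} [Field K]

open Matrix in
theorem Matrix.single_mulVec_eq_piSingle [Fintype n] [DecidableEq m] [DecidableEq n] (i : m) (j : n)
    (c : K) (w : n → K) : single i j c *ᵥ w = Pi.single i (c * w j) := by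
  ext r
  simp [single_mulVec, Pi.single_apply, Function.update_apply]

open Matrix in
theorem Matrix.vecMul_single_eq_piSingle [Fintype m] [DecidableEq m] [DecidableEq n] (i : m) (j : n)
    (c : K) (w : m → K) : w ᵥ* single i j c = Pi.single j (w i * c) := by
  ext r
  by_cases h : j = r
  · subst h
    simp [vecMul, dotProduct, single_apply]
  · simp [vecMul, dotProduct, h, Ne.symm h]

open Matrix in
theorem Matrix.rank_lt_of_ker_lt [Fintype n] {A B : Matrix m n K}
    (h : ∀ w, B *ᵥ w = 0 → A *ᵥ w = 0)
    {y : n → K} (hA : A *ᵥ y = 0) (hB : B *ᵥ y ≠ 0) : A.rank < B.rank := by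
  have hlt : LinearMap.ker B.mulVecLin < LinearMap.ker A.mulVecLin := by
    refine lt_of_le_of_ne (fun w hw => h w hw) fun e => hB ?_
    have : y ∈ LinearMap.ker A.mulVecLin := hA
    rw [← e] at this
    exact this
  have h1 := Submodule.finrank_lt_finrank_of_lt hlt
  have h2 := LinearMap.finrank_range_add_finrank_ker A.mulVecLin
  have h3 := LinearMap.finrank_range_add_finrank_ker B.mulVecLin
  rw [Matrix.rank, Matrix.rank]
  omega

variable [Fintype m] [Fintype n] [DecidableEq m] [DecidableEq n]

/-- `IsLinkedInSteps S j₀ k i`: in the bipartite graph of the relation `S`, the row `i` is joined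
to the column `j₀` by a walk of length `2 * k + 1`. -/
def IsLinkedInSteps {m n : Type*} (S : m → n → Prop) (j₀ : n) : ℕ → m → Prop
  | 0, i => S i j₀
  | k + 1, i => ∃ j i', S i j ∧ S i' j ∧ IsLinkedInSteps S j₀ k i'

open Matrix in
/-- The matrix of a shortest path from the row `i` to the column `j₀`. -/
theorem exists_pathMatrix (S : m → n → Prop) (j₀ : n) (k : ℕ) (i : m)
    (hi : IsLinkedInSteps S j₀ k i) (hmin : ∀ l < k, ¬ IsLinkedInSteps S j₀ l i) :
    ∃ (X : Matrix m n K) (y : n → K) (z : m → K),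
      (∀ r c, X r c ≠ 0 → S r c) ∧ X *ᵥ y = Pi.single i 1 ∧ z ᵥ* X = Pi.single j₀ 1 ∧
      y j₀ ≠ 0 ∧
      (∀ r, (∀ l ≤ k, ¬ IsLinkedInSteps S j₀ l r) → z r = 0 ∧ ∀ c, X r c = 0) ∧
      (∀ c, c ≠ j₀ → (∀ l < k, ∀ r, IsLinkedInSteps S j₀ l r → ¬ S r c) →
        y c = 0 ∧ ∀ r, X r c = 0) := by
  induction k generalizing i with
  | zero =>
    refine ⟨single i j₀ 1, Pi.single j₀ 1, Pi.single i 1, ?_, ?_, ?_, by simp, ?_, ?_⟩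
    · intro r c h
      by_cases hrc : i = r ∧ j₀ = c
      · obtain ⟨rfl, rfl⟩ := hrc
        exact hi
      · simp [hrc] at h
    · ext r; simp [single_apply, Pi.single_apply, eq_comm]
    · ext c; simp [single_apply, Pi.single_apply, eq_comm]
    · intro r hr
      have : i ≠ r := fun h => hr 0 le_rfl (h ▸ hi)
      simp [this, this.symm]
    · intro c hc _
      simp [hc, hc.symm]
  | succ k ih =>
    obtain ⟨j₁, i₁, hij, hi₁j, hi₁⟩ := hi
    obtain ⟨X, y, z, hXS, hXy, hzX, hy, hrow, hcol⟩ := ih i₁ hi₁ fun l hl h =>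
      hmin (l + 1) (by omega) ⟨j₁, i₁, hij, hi₁j, h⟩
    have hj : j₁ ≠ j₀ := fun h => hmin 0 (by omega) (h ▸ hij)
    have hne : i ≠ i₁ := fun h => hmin k (by omega) (h ▸ hi₁)
    -- Minimality of the walk makes row `i` and column `j₁` fresh: `X`, `z` and `y` vanish there.
    obtain ⟨hzi, hXi⟩ := hrow i fun l hl => hmin l (by omega)
    obtain ⟨hyj, hXj⟩ := hcol j₁ hj fun l hl r hr hrj =>
      hmin (l + 1) (by omega) ⟨j₁, r, hij, hrj, hr⟩
    -- The new matrix sends `e_{j₁}` to `e_i + e_{i₁}` and still sends `y` to `e_{i₁}`. On the left,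
    -- `z` now yields `e_{j₀} + z i₁ • e_{j₁}`, and the new row `i` is `e_{j₁}`, which cancels the
    -- excess.
    refine ⟨X + single i j₁ 1 + single i₁ j₁ 1, Pi.single j₁ 1 - y, z - z i₁ • Pi.single i 1,
      ?_, ?_, ?_, ?_, ?_, ?_⟩
    · intro r c h
      by_cases h1 : i = r ∧ j₁ = c
      · obtain ⟨rfl, rfl⟩ := h1
        exact hij
      by_cases h2 : i₁ = r ∧ j₁ = c
      · obtain ⟨rfl, rfl⟩ := h2
        exact hi₁j
      exact hXS r c (by simpa [single_apply, h1, h2] using h)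
    · have h1 : X *ᵥ Pi.single j₁ 1 = 0 := by
        rw [mulVec_single_one]
        exact funext hXj
      rw [mulVec_sub, add_mulVec, add_mulVec, add_mulVec, add_mulVec]
      simp only [h1, hXy, single_mulVec_eq_piSingle, hyj, Pi.single_eq_same, mul_zero, mul_one,
        Pi.single_zero]
      abel
    · have h1 : X.row i = 0 := funext hXi
      simp [vecMul_add, sub_vecMul, hzX, hzi, vecMul_single_eq_piSingle, hne.symm,
        add_assoc, ← Pi.single_add]
      rw [smul_vecMul, single_one_vecMul, h1, smul_zero]
    · simpa [Pi.single_apply, hj, hj.symm] using hy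
    · intro r hr
      obtain ⟨h1, h2⟩ := hrow r fun l hl => hr l (by omega)
      have h3 : i ≠ r := fun h => hr (k + 1) le_rfl (h ▸ ⟨j₁, i₁, hij, hi₁j, hi₁⟩)
      have h4 : i₁ ≠ r := fun h => hr k (by omega) (h ▸ hi₁)
      simp [h1, h2, h3, h4, h3.symm]
    · intro c hc h
      obtain ⟨h1, h2⟩ := hcol c hc fun l hl => h l (by omega)
      have h3 : j₁ ≠ c := fun e => h k (by omega) i₁ hi₁ (e ▸ hi₁j)
      simp [h1, h2, h3, h3.symm]

open Matrix in
/-- If the row `i₀` is joined to the column `j₀` in the graph of `S`, then some matrix supported on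
`S ∪ {(i₀, j₀)}` changes its rank when the entry `(i₀, j₀)` is multiplied by `c ≠ 1`. -/
theorem exists_rank_ne_of_isLinkedInSteps (S : m → n → Prop) {i₀ : m} {j₀ : n} {k : ℕ}
    (hk : IsLinkedInSteps S j₀ k i₀) {c : K} (hc : c ≠ 1) :
    ∃ (X : Matrix m n K) (t : K), (∀ r l, X r l ≠ 0 → S r l) ∧
      (X + single i₀ j₀ t).rank ≠ (X + single i₀ j₀ (c * t)).rank := by
  classical
  have hex : ∃ k, IsLinkedInSteps S j₀ k i₀ := ⟨k, hk⟩
  obtain ⟨X, y, z, hXS, hXy, hzX, hy, -, -⟩ := exists_pathMatrix (K := K) S j₀ (Nat.find hex) i₀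
    (Nat.find_spec hex) fun l hl => Nat.find_min hex hl
  -- Both sides are `z X y`.
  have hzi : z i₀ = y j₀ := by
    have := dotProduct_mulVec z X y
    rw [hXy, hzX] at this
    simpa using this
  have key : ∀ (s : K) (w : n → K), (X + single i₀ j₀ s) *ᵥ w =
      X *ᵥ w + (s * w j₀) • Pi.single i₀ 1 := by
    intro s w
    rw [add_mulVec, single_mulVec_eq_piSingle, ← Pi.single_smul, smul_eq_mul, mul_one]
  -- This `t` makes `y` a kernel vector of `X + t E`, whereas `X + c t E` sends `y` to `(1 - c)
  -- e_{i₀}`. Conversely, pairing `(X + c t E) w = 0` with `z` gives `(1 - c) w j₀ = 0`, so `X w =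
  -- 0` and `w` lies in both kernels.
  refine ⟨X, -(y j₀)⁻¹, hXS, ne_of_lt (rank_lt_of_ker_lt (y := y) ?_ ?_ ?_)⟩
  · intro w hw
    rw [key] at hw ⊢
    have h1 : z ⬝ᵥ (X *ᵥ w + (c * -(y j₀)⁻¹ * w j₀) • Pi.single i₀ 1) = 0 := by
      rw [hw, dotProduct_zero]
    rw [dotProduct_add, dotProduct_mulVec, hzX] at h1
    simp only [dotProduct_smul, dotProduct_single, single_dotProduct, hzi, smul_eq_mul] at h1
    have h2 : w j₀ = 0 := by
      have h3 : (1 - c) * w j₀ = 0 := by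
        field_simp at h1
        linear_combination h1
      exact (mul_eq_zero.mp h3).resolve_left (sub_ne_zero.mpr hc.symm)
    simpa [h2] using hw
  · rw [key, hXy]
    ext r
    simp [Pi.single_apply, hy]
  · rw [key, hXy]
    intro h
    have := congrFun h i₀
    simp only [Pi.add_apply, Pi.single_eq_same, Pi.smul_apply, Pi.zero_apply, smul_eq_mul] at this
    field_simp at this
    exact hc (by linear_combination -this)

open Matrix in
theorem Matrix.rank_scale_rows_cols (a : m → Kˣ) (b : n → Kˣ) (X : Matrix m n K) :
    (of fun i j => (a i : K) * b j * X i j).rank = X.rank := by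
  have h : (of fun i j => (a i : K) * b j * X i j) =
      diagonal (fun i => (a i : K)) * X * diagonal (fun j => (b j : K)) := by
    ext i j
    simp [mul_right_comm]
  have ha : IsUnit (diagonal fun i => (a i : K)).det := by
    rw [det_diagonal, isUnit_iff_ne_zero, Finset.prod_ne_zero_iff]
    simp
  have hb : IsUnit (diagonal fun i => (b i : K)).det := by
    rw [det_diagonal, isUnit_iff_ne_zero, Finset.prod_ne_zero_iff]
    simp
  rw [h, rank_mul_eq_left_of_isUnit_det _ _ hb, rank_mul_eq_right_of_isUnit_det _ _ ha]

open Matrix in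
/-- Entrywise multiplication by `g` that preserves the rank of all matrices supported in a
relation is, on that relation, multiplication of rows and columns by scalars. -/
theorem exists_eq_mul_of_rank_preserving (ρ : m → n → Prop) (g : m → n → Kˣ)
    (hg : ∀ X : Matrix m n K, (∀ i j, X i j ≠ 0 → ρ i j) →
      (of fun i j => (g i j : K) * X i j).rank = X.rank) :
    ∃ (a : m → Kˣ) (b : n → Kˣ), ∀ i j, ρ i j → g i j = a i * b j := by
  classical
  -- The factorization is built by adding the edges of the bipartite graph one at a time.
  suffices H : ∀ s : Finset (m × n), (∀ p ∈ s, ρ p.1 p.2) →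
      ∃ (a : m → Kˣ) (b : n → Kˣ), ∀ p ∈ s, g p.1 p.2 = a p.1 * b p.2 by
    obtain ⟨a, b, h⟩ := H (Finset.univ.filter fun p => ρ p.1 p.2) (by simp)
    exact ⟨a, b, fun i j hij => h (i, j) (by simpa using hij)⟩
  intro s
  induction s using Finset.induction_on with
  | empty => exact fun _ => ⟨1, 1, by simp⟩
  | insert e s he ih =>
    intro hs
    obtain ⟨i₀, j₀⟩ := e
    obtain ⟨a, b, hab⟩ := ih fun p hp => hs p (Finset.mem_insert_of_mem hp)
    -- `c` is the error of the current factorization at the new edge.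
    set c : Kˣ := g i₀ j₀ * (a i₀ * b j₀)⁻¹ with hcdef
    have hgc : g i₀ j₀ = c * (a i₀ * b j₀) := by
      rw [hcdef, inv_mul_cancel_right]
    by_cases hc : c = 1
    · refine ⟨a, b, fun p hp => ?_⟩
      rcases Finset.mem_insert.mp hp with rfl | hp
      · simp [hgc, hc]
      · exact hab p hp
    set S : m → n → Prop := fun i j => (i, j) ∈ s with hS
    -- If the new edge closed a cycle, multiplying `X + t E` entrywise by `g` would be, up to row
    -- and column scalings, passing to `X + c t E`, which has a different rank.
    have hi₀ : ∀ k, ¬ IsLinkedInSteps S j₀ k i₀ := by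
      intro k hk
      obtain ⟨X, t, hXS, hne⟩ := exists_rank_ne_of_isLinkedInSteps S hk
        (c := (c : K)) (by simpa using hc)
      apply hne
      have h0 : X i₀ j₀ = 0 := by
        by_contra h
        exact he (hXS _ _ h)
      rw [← hg (X + single i₀ j₀ t), ← rank_scale_rows_cols a b (X + single i₀ j₀ ((c : K) * t))]
      · congr 1
        ext i j
        by_cases h : i₀ = i ∧ j₀ = j
        · obtain ⟨rfl, rfl⟩ := h
          simp [h0, hgc]
          ring
        · by_cases hX : X i j = 0
          · simp [single_apply, h, hX]
          · have := hab (i, j) (hXS i j hX)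
            simp only at this
            simp [single_apply, h, this]
      · intro i j hX
        by_cases h : i₀ = i ∧ j₀ = j
        · obtain ⟨rfl, rfl⟩ := h
          exact hs _ (Finset.mem_insert_self _ _)
        · simp only [Matrix.add_apply, single_apply, h, if_false, add_zero] at hX
          exact hs (i, j) (Finset.mem_insert_of_mem (hXS _ _ hX))
    set W : m → Prop := fun i => ∃ k, IsLinkedInSteps S j₀ k i with hW
    -- The new edge joins different components, so everything outside the component of `j₀` may be
    -- rescaled: rows by `c`, columns by `c⁻¹`. Old edges are unaffected, and the new one gains the
    -- factor `c`.
    refine ⟨fun i => if W i then a i else c * a i,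
      fun j => if j = j₀ ∨ ∃ i, W i ∧ S i j then b j else c⁻¹ * b j, fun p hp => ?_⟩
    rcases Finset.mem_insert.mp hp with rfl | hps
    · have : ¬ W i₀ := fun ⟨k, hk⟩ => hi₀ k hk
      simp [this, hgc, mul_assoc]
    · obtain ⟨i, j⟩ := p
      by_cases hWi : W i
      · have : ∃ i, W i ∧ S i j := ⟨i, hWi, hps⟩
        simp only [hWi, this, or_true, if_true]
        exact hab _ hps
      · have : ¬ (j = j₀ ∨ ∃ i, W i ∧ S i j) := by
          rintro (rfl | ⟨i', ⟨k, hk⟩, hi'⟩)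
          · exact hWi ⟨0, hps⟩
          · exact hWi ⟨k + 1, j, i', hps, hi', hk⟩
        simp only [hWi, this, if_false]
        rw [hab _ hps]
        simp only
        rw [mul_mul_mul_comm, mul_inv_cancel, one_mul]

end HadamardWeights

/-! ### Rank-one matrices and rank of block sums -/

section BlockRank

variable {K m n : Type*} [Field K] [Fintype n]

open Matrix in
theorem Matrix.exists_eq_vecMulVec_of_rank_le_one [DecidableEq n] {M : Matrix m n K}
    (h : M.rank ≤ 1) : ∃ (u : m → K) (v : n → K), M = vecMulVec u v := by
  obtain ⟨⟨u, hu⟩, H⟩ := finrank_le_one_iff.mp h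
  have H' : ∀ j, ∃ c : K, c • u = M *ᵥ Pi.single j 1 := fun j => by
    obtain ⟨c, hc⟩ := H ⟨M *ᵥ Pi.single j 1, ⟨Pi.single j 1, rfl⟩⟩
    exact ⟨c, congrArg Subtype.val hc⟩
  choose v hv using H'
  refine ⟨u, v, ?_⟩
  ext i j
  have := congrFun (hv j) i
  simp only [mulVec_single_one, Pi.smul_apply, smul_eq_mul, col_apply] at this
  rw [vecMulVec_apply, ← this, mul_comm]

theorem Matrix.mul_eq_mul_of_rank_le_one [DecidableEq n] {M : Matrix m n K} (h : M.rank ≤ 1)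
    (i j : m) (k l : n) : M i k * M j l = M i l * M j k := by
  obtain ⟨u, v, rfl⟩ := exists_eq_vecMulVec_of_rank_le_one h
  simp only [vecMulVec_apply]
  ring

variable [DecidableEq n]

open Matrix in
theorem Matrix.rank_eq_zero_iff_eq_zero {A : Matrix m n K} : A.rank = 0 ↔ A = 0 := by
  refine ⟨fun h => ?_, fun h => by rw [h, rank_zero]⟩
  have h1 : A.mulVecLin = 0 := by
    rw [← LinearMap.range_eq_bot]
    exact Submodule.finrank_eq_zero.mp h
  ext a b
  simpa using congrFun (LinearMap.congr_fun h1 (Pi.single b 1)) a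

-- `A` and `B` live in complementary corners: their ranges meet trivially, and composing `A + B`
-- with `P` or `1 - P` recovers each of them.
open Matrix in
theorem Matrix.rank_add_of_isIdempotentElem {P A B : Matrix n n K}
    (hPA : P * A = A) (hAP : A * P = A) (hPB : P * B = 0) (hBP : B * P = 0) :
    (A + B).rank = A.rank + B.rank := by
  have hsup : LinearMap.range (A + B).mulVecLin =
      LinearMap.range A.mulVecLin ⊔ LinearMap.range B.mulVecLin := by
    apply le_antisymm
    · rintro _ ⟨w, rfl⟩
      rw [mulVecLin_apply, add_mulVec]
      exact Submodule.add_mem_sup ⟨w, rfl⟩ ⟨w, rfl⟩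
    · rw [sup_le_iff]
      constructor
      · rintro _ ⟨w, rfl⟩
        refine ⟨P *ᵥ w, ?_⟩
        rw [mulVecLin_apply, mulVecLin_apply, mulVec_mulVec, add_mul, hAP, hBP, add_zero]
      · rintro _ ⟨w, rfl⟩
        refine ⟨(1 - P) *ᵥ w, ?_⟩
        rw [mulVecLin_apply, mulVecLin_apply, mulVec_mulVec, mul_sub, mul_one, add_mul, hAP, hBP]
        simp
  have hinf : LinearMap.range A.mulVecLin ⊓ LinearMap.range B.mulVecLin = ⊥ := by
    rw [Submodule.eq_bot_iff]
    rintro _ ⟨⟨w, rfl⟩, ⟨w', h⟩⟩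
    simp only [mulVecLin_apply] at h ⊢
    rw [← hPA, ← mulVec_mulVec, ← h, mulVec_mulVec, hPB, zero_mulVec]
  have := Submodule.finrank_sup_add_finrank_inf_eq
    (LinearMap.range A.mulVecLin) (LinearMap.range B.mulVecLin)
  rw [hinf, finrank_bot, add_zero, ← hsup] at this
  exact this

-- Rank is additive over the blocks `P X` and `(1 - P) X`, and transposing the second keeps its
-- rank.
open Matrix in
theorem Matrix.rank_partialTranspose {P X : Matrix n n K} (hP : IsIdempotentElem P)
    (hPt : Pᵀ = P) (hPX : P * X = X * P) : (P * X + (1 - P) * Xᵀ).rank = X.rank := by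
  have hP' : P * P = P := hP
  have hPXt : P * Xᵀ = Xᵀ * P := by
    have := congrArg transpose hPX
    rw [transpose_mul, transpose_mul, hPt] at this
    exact this.symm
  have h1 : P * (P * X) = P * X := by rw [← mul_assoc, hP']
  have h2 : P * X * P = P * X := by rw [mul_assoc, ← hPX, h1]
  have h0 : P * (1 - P) = 0 := by rw [mul_sub, mul_one, hP', sub_self]
  have h0' : (1 - P) * P = 0 := by rw [sub_mul, one_mul, hP', sub_self]
  have h3 : ∀ Y, P * ((1 - P) * Y) = 0 := fun Y => by rw [← mul_assoc, h0, zero_mul]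
  have h4 : (1 - P) * Xᵀ * P = 0 := by rw [mul_assoc, ← hPXt, ← mul_assoc, h0', zero_mul]
  have h5 : (1 - P) * X * P = 0 := by rw [mul_assoc, ← hPX, ← mul_assoc, h0', zero_mul]
  have h6 : ((1 - P) * Xᵀ).rank = ((1 - P) * X).rank := by
    rw [← rank_transpose ((1 - P) * X), transpose_mul, transpose_sub, transpose_one, hPt,
      mul_sub, sub_mul, mul_one, one_mul, hPXt]
  rw [rank_add_of_isIdempotentElem h1 h2 (h3 _) h4, h6,
    ← rank_add_of_isIdempotentElem h1 h2 (h3 _) h5, ← add_mul, add_sub_cancel, one_mul]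

end BlockRank

/-! ### Simultaneous diagonalization and images of matrix units -/

section RankPreservers

variable {n : Type*} [Fintype n] [DecidableEq n] {K : Type*} [Field K]

open Matrix in
/-- Matrices of rank one that sum to the identity are simultaneously similar to the diagonal
matrix units. -/
theorem exists_conj_eq_single_of_sum_eq_one (F : n → Matrix n n K) (hF : ∀ i, (F i).rank ≤ 1)
    (hsum : ∑ i, F i = 1) :
    ∃ U : (Matrix n n K)ˣ, ∀ i, (↑U⁻¹ : Matrix n n K) * F i * (U : Matrix n n K) = single i i 1 := by
  choose u v huv using fun i => exists_eq_vecMulVec_of_rank_le_one (hF i)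
  -- With `F i = u i (v i)ᵗ`, the sum is the product of the matrix with columns `u i` and the matrix
  -- with rows `v i`. A one-sided inverse is two-sided, so `v i ⬝ᵥ u j = δ_ij`.
  have h : (of fun a i => u i a) * (of v) = 1 := by
    rw [← hsum]
    ext a b
    simp [huv, mul_apply, Matrix.sum_apply, vecMulVec_apply]
  have h' := mul_eq_one_comm.mp h
  refine ⟨⟨_, _, h, h'⟩, fun i => ?_⟩
  have hu : (of v) *ᵥ u i = Pi.single i 1 := by
    ext k
    simpa [mul_apply, mulVec, dotProduct, one_apply, Pi.single_apply]
      using congrFun (congrFun h' k) i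
  have hv : v i ᵥ* (of fun a i => u i a) = Pi.single i 1 := by
    ext k
    simpa [mul_apply, vecMul, dotProduct, one_apply, Pi.single_apply, eq_comm]
      using congrFun (congrFun h' i) k
  change of v * F i * (of fun a i => u i a) = _
  rw [huv, mul_vecMulVec, vecMulVec_mul, hu, hv]
  ext a b
  simp [vecMulVec_apply, Pi.single_apply, single_apply, ← ite_and, eq_comm]
  exact if_congr and_comm rfl rfl

variable {ρ : n → n → Prop} {f : Matrix n n K →ₗ[K] Matrix n n K}

theorem Matrix.single_apply_eq_zero_of_not_rel {n : Type*} [DecidableEq n] {ρ : n → n → Prop}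
    {i j a b : n} (h : ρ i j) (hab : ¬ ρ a b) (c : K) : single i j c a b = 0 := by
  rw [single_apply, if_neg]
  rintro ⟨rfl, rfl⟩
  exact hab h

-- `E_ij + t E_ii` and `E_ij + t E_jj` have rank at most one for every `t`, and so do their images.
-- This confines the image of `E_ij` to positions `(i, j)` and `(j, i)`, of which a further minor
-- allows only one.
open Matrix in
theorem apply_single_of_rank_preserving
    (hf : ∀ X : Matrix n n K, (∀ i j, X i j ≠ 0 → ρ i j) → (f X).rank = X.rank)
    (hrefl : ∀ i, ρ i i) (hd : ∀ i, f (single i i 1) = single i i 1)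
    {i j : n} (hij : i ≠ j) (h : ρ i j) :
    (∃ c : Kˣ, f (single i j 1) = single i j (c : K)) ∨
      ∃ c : Kˣ, f (single i j 1) = single j i (c : K) := by
  set R := f (single i j 1) with hR
  have hrow : ∀ t : K, (R + single i i t).rank ≤ 1 := by
    intro t
    have h1 : R + single i i t = f (single i j 1 + t • single i i 1) := by
      rw [map_add, map_smul, hd, ← hR]; simp
    rw [h1, hf]
    · have h2 : single i j 1 + t • single i i 1 =
          vecMulVec (Pi.single i 1) (Pi.single j 1 + t • Pi.single i 1 : n → K) := by
        ext a b
        by_cases ha : i = a <;> simp [vecMulVec_apply, Pi.single_apply, single_apply, ha, eq_comm]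
      rw [h2]
      exact rank_vecMulVec_le _ _
    · intro a b hab
      by_contra hρ
      rw [Matrix.add_apply, Matrix.smul_apply, single_apply_eq_zero_of_not_rel h hρ,
        single_apply_eq_zero_of_not_rel (hrefl i) hρ] at hab
      simp at hab
  have hcol : ∀ t : K, (R + single j j t).rank ≤ 1 := by
    intro t
    have h1 : R + single j j t = f (single i j 1 + t • single j j 1) := by
      rw [map_add, map_smul, hd, ← hR]; simp
    rw [h1, hf]
    · have h2 : single i j 1 + t • single j j 1 =
          vecMulVec (Pi.single i 1 + t • Pi.single j 1 : n → K) (Pi.single j 1) := by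
        ext a b
        by_cases ha : j = b <;> simp [vecMulVec_apply, Pi.single_apply, single_apply, ha, eq_comm]
      rw [h2]
      exact rank_vecMulVec_le _ _
    · intro a b hab
      by_contra hρ
      rw [Matrix.add_apply, Matrix.smul_apply, single_apply_eq_zero_of_not_rel h hρ,
        single_apply_eq_zero_of_not_rel (hrefl j) hρ] at hab
      simp at hab
  have hzero : ∀ p : n, (∀ t : K, (R + single p p t).rank ≤ 1) →
      ∀ k l, k ≠ p → l ≠ p → R k l = 0 := by
    intro p hp k l hk hl
    -- The minors on rows `p, k` and columns `p, l` at `t = 1` and `t = 0` differ by exactly `R k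
    -- l`.
    have h0 := mul_eq_mul_of_rank_le_one (hp 0) p k p l
    have h1 := mul_eq_mul_of_rank_le_one (hp 1) p k p l
    simp [hk.symm, hl.symm] at h0 h1
    linear_combination h1 - h0
  have hR0 : ∀ k l, ¬ (k = i ∧ l = j) → ¬ (k = j ∧ l = i) → R k l = 0 := by
    intro k l h1 h2
    by_cases hki : k = i
    · by_cases hlj : l = j
      · exact absurd ⟨hki, hlj⟩ h1
      · exact hzero j hcol k l (by rw [hki]; exact hij) hlj
    · by_cases hli : l = i
      · exact hzero j hcol k l (fun hkj => h2 ⟨hkj, hli⟩) (by rw [hli]; exact hij)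
      · exact hzero i hrow k l hki hli
  have hprod : R i j * R j i = 0 := by
    have := mul_eq_mul_of_rank_le_one (hrow 0) i j j i
    simp only [single_zero, add_zero] at this
    rw [this, hR0 i i (by simp [hij]) (by simp [hij]), zero_mul]
  have hne : R ≠ 0 := by
    intro h0
    have h1 : single i j (1 : K) = 0 := by
      refine rank_eq_zero_iff_eq_zero.mp ?_
      rw [← hf _ fun a b hab => by_contra fun hρ => hab (single_apply_eq_zero_of_not_rel h hρ _),
        ← hR, h0, rank_zero]
    simpa using congrFun (congrFun h1 i) j
  by_cases hRij : R i j = 0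
  · have hRji : R j i ≠ 0 := by
      intro h0
      apply hne
      ext a b
      by_cases h1 : a = i ∧ b = j
      · rw [h1.1, h1.2, hRij, Matrix.zero_apply]
      by_cases h2 : a = j ∧ b = i
      · rw [h2.1, h2.2, h0, Matrix.zero_apply]
      exact hR0 a b h1 h2
    refine Or.inr ⟨Units.mk0 _ hRji, ?_⟩
    ext a b
    by_cases h2 : a = j ∧ b = i
    · obtain ⟨rfl, rfl⟩ := h2
      simp
    by_cases h1 : a = i ∧ b = j
    · obtain ⟨rfl, rfl⟩ := h1
      simp [hRij, hij, hij.symm]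
    rw [hR0 a b h1 h2, single_apply, if_neg (fun h => h2 ⟨h.1.symm, h.2.symm⟩)]
  · have hRji : R j i = 0 := (mul_eq_zero.mp hprod).resolve_left hRij
    refine Or.inl ⟨Units.mk0 _ hRij, ?_⟩
    ext a b
    by_cases h1 : a = i ∧ b = j
    · obtain ⟨rfl, rfl⟩ := h1
      simp
    by_cases h2 : a = j ∧ b = i
    · obtain ⟨rfl, rfl⟩ := h2
      simp [hRji, hij, hij.symm]
    rw [hR0 a b h1 h2, single_apply, if_neg (fun h => h1 ⟨h.1.symm, h.2.symm⟩)]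

-- `E_ij + E_ik` has rank one, but the minor of its image on rows `i, k` and columns `j, i` would be
-- `c d ≠ 0`.
open Matrix in
theorem not_straight_and_flipped_of_same_row
    (hf : ∀ X : Matrix n n K, (∀ i j, X i j ≠ 0 → ρ i j) → (f X).rank = X.rank)
    {i j k : n} (hij : i ≠ j) (hik : i ≠ k)
    (h : ρ i j) (h' : ρ i k) {c d : Kˣ} (hc : f (single i j 1) = single i j (c : K))
    (hd : f (single i k 1) = single k i (d : K)) : False := by
  have h1 : (f (single i j 1 + single i k 1)).rank ≤ 1 := by
    rw [hf]
    · have h2 : single i j 1 + single i k 1 =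
          vecMulVec (Pi.single i 1) (Pi.single j 1 + Pi.single k 1 : n → K) := by
        ext a b
        by_cases ha : i = a <;> simp [vecMulVec_apply, Pi.single_apply, single_apply, ha, eq_comm]
      rw [h2]
      exact rank_vecMulVec_le _ _
    · intro a b hab
      by_contra hρ
      rw [Matrix.add_apply, single_apply_eq_zero_of_not_rel h hρ,
        single_apply_eq_zero_of_not_rel h' hρ] at hab
      simp at hab
  rw [map_add, hc, hd] at h1
  simpa [hij, hik, hij.symm, hik.symm] using mul_eq_mul_of_rank_le_one h1 i k j i

open Matrix in
theorem not_straight_and_flipped_of_same_col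
    (hf : ∀ X : Matrix n n K, (∀ i j, X i j ≠ 0 → ρ i j) → (f X).rank = X.rank)
    {i j k : n} (hij : i ≠ j) (hjk : j ≠ k)
    (h : ρ i j) (h' : ρ k j) {c d : Kˣ} (hc : f (single i j 1) = single i j (c : K))
    (hd : f (single k j 1) = single j k (d : K)) : False := by
  have h1 : (f (single i j 1 + single k j 1)).rank ≤ 1 := by
    rw [hf]
    · have h2 : single i j 1 + single k j 1 =
          vecMulVec (Pi.single i 1 + Pi.single k 1 : n → K) (Pi.single j 1) := by
        ext a b
        by_cases ha : j = b <;> simp [vecMulVec_apply, Pi.single_apply, single_apply, ha, eq_comm]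
      rw [h2]
      exact rank_vecMulVec_le _ _
    · intro a b hab
      by_contra hρ
      rw [Matrix.add_apply, single_apply_eq_zero_of_not_rel h hρ,
        single_apply_eq_zero_of_not_rel h' hρ] at hab
      simp at hab
  rw [map_add, hc, hd] at h1
  simpa [hij, hjk, hij.symm, hjk.symm] using mul_eq_mul_of_rank_le_one h1 i j j k

-- The obstruction here is injectivity: both images would be multiples of `E_ij`, so a nonzero
-- combination of `E_ij` and `E_ji` would be killed.
open Matrix in
theorem not_straight_and_flipped_of_symm
    (hf : ∀ X : Matrix n n K, (∀ i j, X i j ≠ 0 → ρ i j) → (f X).rank = X.rank)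
    {i j : n} (hij : i ≠ j)
    (h : ρ i j) (h' : ρ j i) {c d : Kˣ} (hc : f (single i j 1) = single i j (c : K))
    (hd : f (single j i 1) = single i j (d : K)) : False := by
  have h1 : f ((d : K) • single i j 1 - (c : K) • single j i 1) = 0 := by
    rw [map_sub, map_smul, map_smul, hc, hd]
    simp [mul_comm]
  have h2 : (d : K) • single i j (1 : K) - (c : K) • single j i (1 : K) = 0 := by
    rw [← rank_eq_zero_iff_eq_zero, ← hf, h1, rank_zero]
    intro a b hab
    by_contra hρ
    rw [Matrix.sub_apply, Matrix.smul_apply, Matrix.smul_apply,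
      single_apply_eq_zero_of_not_rel h hρ, single_apply_eq_zero_of_not_rel h' hρ] at hab
    simp at hab
  simpa [hij, hij.symm] using congrFun (congrFun h2 i) j

open Matrix in
theorem exists_apply_single_eq_ite [IsPreorder n ρ]
    (hf : ∀ X : Matrix n n K, (∀ i j, X i j ≠ 0 → ρ i j) → (f X).rank = X.rank)
    (hd : ∀ i, f (single i i 1) = single i i 1) :
    ∃ (p : n → Prop) (g : n → n → Kˣ), (∀ i j, ρ i j → (p i ↔ p j)) ∧ (∀ i, g i i = 1) ∧
      ∀ i j, ρ i j → (p i → f (single i j 1) = single i j (g i j : K)) ∧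
        (¬ p i → f (single i j 1) = single j i (g i j : K)) := by
  classical
  set Str : n → n → Prop := fun i j => ∃ c : Kˣ, f (single i j 1) = single i j (c : K) with hStr
  have dich : ∀ {i j}, i ≠ j → ρ i j →
      Str i j ∨ ∃ c : Kˣ, f (single i j 1) = single j i (c : K) := fun hij h =>
    apply_single_of_rank_preserving hf (refl_of ρ) hd hij h
  have row : ∀ {i j k}, i ≠ j → i ≠ k → ρ i j → ρ i k → Str i j → Str i k := by
    rintro i j k hij hik h h' ⟨c, hc⟩
    refine (dich hik h').resolve_right ?_
    rintro ⟨d, hd⟩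
    exact not_straight_and_flipped_of_same_row hf hij hik h h' hc hd
  have col : ∀ {i j k}, i ≠ j → k ≠ j → ρ i j → ρ k j → Str i j → Str k j := by
    rintro i j k hij hkj h h' ⟨c, hc⟩
    refine (dich hkj h').resolve_right ?_
    rintro ⟨d, hd⟩
    exact not_straight_and_flipped_of_same_col hf hij hkj.symm h h' hc hd
  have symm : ∀ {i j}, i ≠ j → ρ i j → ρ j i → Str i j → Str j i := by
    rintro i j hij h h' ⟨c, hc⟩
    refine (dich hij.symm h').resolve_right ?_
    rintro ⟨d, hd⟩
    exact not_straight_and_flipped_of_symm hf hij h h' hc hd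
  -- Straightness passes along a chain through the composite edge `(i, k)`, which shares a row with
  -- `(i, j)` and a column with `(j, k)`.
  have next : ∀ {i j k}, i ≠ j → j ≠ k → ρ i j → ρ j k → Str i j → Str j k := by
    intro i j k hij hjk h h' hs
    by_cases hik : i = k
    · subst hik
      exact symm hij h h' hs
    have h'' : ρ i k := _root_.trans h h'
    exact col hik hjk h'' h' (row hij hik h h'' hs)
  have prev : ∀ {i j k}, i ≠ j → j ≠ k → ρ i j → ρ j k → Str j k → Str i j := by
    intro i j k hij hjk h h' hs
    by_cases hik : i = k
    · subst hik
      exact symm hjk h' h hs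
    have h'' : ρ i k := _root_.trans h h'
    exact row hik hij h'' h (col hjk hik h' h'' hs)
  -- One straight edge at `i` forces all of them to be straight, by `hpl` and `hpr`; an isolated
  -- index satisfies `p` vacuously.
  set p : n → Prop := fun i => ∀ j, j ≠ i → (ρ i j → Str i j) ∧ (ρ j i → Str j i) with hp
  have hpl : ∀ {i j}, i ≠ j → ρ i j → Str i j → p i := fun hij h hs k hk =>
    ⟨fun h' => row hij hk.symm h h' hs, fun h' => prev hk hij h' h hs⟩
  have hpr : ∀ {i j}, i ≠ j → ρ i j → Str i j → p j := fun hij h hs k hk =>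
    ⟨fun h' => next hij hk.symm h h' hs, fun h' => col hij hk h h' hs⟩
  have hg : ∀ i j, ∃ c : Kˣ, (i = j → c = 1) ∧ (ρ i j →
      (p i → f (single i j 1) = single i j (c : K)) ∧
        (¬ p i → f (single i j 1) = single j i (c : K))) := by
    intro i j
    by_cases hij : i = j
    · subst hij
      exact ⟨1, fun _ => rfl, fun _ => by simp [hd]⟩
    by_cases h : ρ i j
    · by_cases hpi : p i
      · obtain ⟨c, hc⟩ := (hpi j (Ne.symm hij)).1 h
        exact ⟨c, fun e => absurd e hij, fun _ => ⟨fun _ => hc, fun h' => absurd hpi h'⟩⟩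
      · obtain ⟨c, hc⟩ := (dich hij h).resolve_left fun hs => hpi (hpl hij h hs)
        exact ⟨c, fun e => absurd e hij, fun _ => ⟨fun h' => absurd h' hpi, fun _ => hc⟩⟩
    · exact ⟨1, fun _ => rfl, fun h' => absurd h' h⟩
  choose g hg1 hg2 using hg
  refine ⟨p, g, fun i j h => ?_, fun i => hg1 i i rfl, hg2⟩
  by_cases hij : i = j
  · rw [hij]
  · exact ⟨fun hi => hpr hij h ((hi j (Ne.symm hij)).1 h), fun hj => hpl hij h ((hj i hij).2 h)⟩

open Matrix in
theorem Matrix.diagonal_mul_comm_of_rel {P : n → K} (hP : ∀ i j, ρ i j → P i = P j)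
    {X : Matrix n n K} (hX : ∀ i j, X i j ≠ 0 → ρ i j) : diagonal P * X = X * diagonal P := by
  ext i j
  rw [diagonal_mul, mul_diagonal]
  by_cases h : X i j = 0
  · simp [h]
  · rw [hP i j (hX i j h), mul_comm]

open Matrix in
theorem exists_eq_conj_partialTranspose [IsPreorder n ρ]
    (hf : ∀ X : Matrix n n K, (∀ i j, X i j ≠ 0 → ρ i j) → (f X).rank = X.rank)
    (hd : ∀ i, f (single i i 1) = single i i 1) :
    ∃ (D : (Matrix n n K)ˣ) (P : n → K), (∀ i j, ρ i j → P i = P j) ∧ (∀ i, P i * P i = P i) ∧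
      ∀ X : Matrix n n K, (∀ i j, X i j ≠ 0 → ρ i j) →
        f X = (D : Matrix n n K) * (diagonal P * X + (1 - diagonal P) * Xᵀ) *
          ((D⁻¹ : (Matrix n n K)ˣ) : Matrix n n K) := by
  classical
  obtain ⟨p, g, hp, hg1, hg⟩ := exists_apply_single_eq_ite hf hd
  set P : n → K := fun i => if p i then 1 else 0 with hPdef
  have hP : ∀ i j, ρ i j → P i = P j := fun i j h => by simp [hPdef, hp i j h]
  have hPP : ∀ i, P i * P i = P i := fun i => by simp [hPdef]
  have hid : IsIdempotentElem (diagonal P) := by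
    rw [IsIdempotentElem, diagonal_mul_diagonal]
    simp only [hPP]
  have entry : ∀ (Y : Matrix n n K) (a b : n), (diagonal P * Y + (1 - diagonal P) * Yᵀ) a b =
      if p a then Y a b else Y b a := by
    intro Y a b
    rw [← diagonal_one, diagonal_sub, Matrix.add_apply, diagonal_mul, diagonal_mul,
      transpose_apply]
    by_cases h : p a <;> simp [hPdef, h]
  have hfX : ∀ X : Matrix n n K, (∀ i j, X i j ≠ 0 → ρ i j) → ∀ a b,
      f X a b = if p a then g a b * X a b else g b a * X b a := by
    -- Linearity of the claimed formula reduces the comparison to the matrix units in `ρ`.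
    let F : Matrix n n K →ₗ[K] Matrix n n K :=
      { toFun := fun X => of fun a b => if p a then g a b * X a b else g b a * X b a
        map_add' := fun X Y => by ext a b; by_cases h : p a <;> simp [h, mul_add]
        map_smul' := fun c X => by ext a b; by_cases h : p a <;> simp [h, mul_left_comm] }
    intro X hX a b
    suffices f X = F X by rw [this]; rfl
    rw [matrix_eq_sum_single X]
    simp only [map_sum]
    refine Finset.sum_congr rfl fun i _ => Finset.sum_congr rfl fun j _ => ?_
    by_cases h : X i j = 0
    · simp [h]
    have hρ := hX i j h
    have h1 : single i j (X i j) = X i j • single i j (1 : K) := by simp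
    rw [h1, map_smul, map_smul]
    congr 1
    ext a b
    change _ = if p a then g a b * single i j (1 : K) a b else g b a * single i j (1 : K) b a
    by_cases hpi : p i
    · rw [(hg i j hρ).1 hpi]
      by_cases hab : i = a ∧ j = b
      · obtain ⟨rfl, rfl⟩ := hab
        simp [hpi]
      · by_cases hba : i = b ∧ j = a
        · obtain ⟨rfl, rfl⟩ := hba
          simp [hab, (hp i j hρ).mp hpi]
        · simp [hab, hba]
    · rw [(hg i j hρ).2 hpi]
      have hpj : ¬ p j := fun h => hpi ((hp i j hρ).mpr h)
      by_cases hba : i = b ∧ j = a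
      · obtain ⟨rfl, rfl⟩ := hba
        simp [hpj]
      · by_cases hab : i = a ∧ j = b
        · obtain ⟨rfl, rfl⟩ := hab
          have hba' : ¬ (j = i ∧ i = j) := fun h => hba h.symm
          simp [hba, hba', hpi]
        · have hba' : ¬ (j = a ∧ i = b) := fun h => hba h.symm
          simp [hab, hba, hba']
  -- `f X` is the partial transpose of the entrywise product of `g` and `X`, hence has the rank of
  -- that product.
  obtain ⟨a, b, hab⟩ := exists_eq_mul_of_rank_preserving ρ g fun X hX => by
    have hY : ∀ i j, (of fun i j => (g i j : K) * X i j) i j ≠ 0 → ρ i j := fun i j h =>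
      hX i j (right_ne_zero_of_mul h)
    rw [← hf X hX, ← rank_partialTranspose hid (diagonal_transpose P)
      (diagonal_mul_comm_of_rel hP hY)]
    congr 1
    ext i j
    rw [entry, hfX X hX]
    rfl
  have hb : ∀ i, b i = (a i)⁻¹ := fun i => by
    have := hab i i (refl_of ρ i)
    rw [hg1] at this
    exact eq_inv_of_mul_eq_one_right this.symm
  -- On flipped components the entry `(i, j)` carries `g j i = a j / a i`, whence the inverse there.
  let d : n → Kˣ := fun i => if p i then a i else (a i)⁻¹
  let D : (Matrix n n K)ˣ := ⟨diagonal fun i => (d i : K), diagonal fun i => ((d i)⁻¹ : Kˣ),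
    by simp [diagonal_mul_diagonal], by simp [diagonal_mul_diagonal]⟩
  refine ⟨D, P, hP, hPP, fun X hX => ?_⟩
  ext i j
  change _ = (diagonal (fun i => (d i : K)) * (diagonal P * X + (1 - diagonal P) * Xᵀ) * diagonal fun i => (((d i)⁻¹ : Kˣ) : K)) i j
  rw [mul_diagonal, diagonal_mul, entry, hfX X hX]
  by_cases hi : p i
  · simp only [hi, if_true]
    by_cases h0 : X i j = 0
    · simp [h0]
    have hρ := hX i j h0
    have hj := (hp i j hρ).mp hi
    rw [hab i j hρ, hb]
    simp only [d, hi, hj, if_true]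
    push_cast
    ring
  · simp only [hi, if_false]
    by_cases h0 : X j i = 0
    · simp [h0]
    have hρ := hX j i h0
    have hj : ¬ p j := fun h => hi ((hp j i hρ).mp h)
    rw [hab j i hρ, hb]
    simp only [d, hi, hj, if_false, inv_inv]
    push_cast
    ring

end RankPreservers

/-! ### Structural matrix algebras and the two claims -/

open Matrix in
theorem single_mem_structuralMatrixAlgebra {n : ℕ} {ρ : Fin n → Fin n → Prop}
    [IsPreorder (Fin n) ρ] {i j : Fin n} (h : ρ i j) (c : ℂ) :
    single i j c ∈ structuralMatrixAlgebra ρ := fun _ _ hab => by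
  by_contra hρ
  exact hab (single_apply_eq_zero_of_not_rel h hρ c)

open Matrix in
theorem diagonal_mem_structuralMatrixAlgebra {n : ℕ} {ρ : Fin n → Fin n → Prop}
    [IsPreorder (Fin n) ρ] (d : Fin n → ℂ) : diagonal d ∈ structuralMatrixAlgebra ρ := by
  intro i j h
  by_cases hij : i = j
  · exact hij ▸ refl_of ρ i
  · exact absurd (diagonal_apply_ne d hij) h

-- Commuting with every `E_ii` forces a central element to be diagonal.
open Matrix in
theorem transpose_eq_self_of_mem_center {n : ℕ} {ρ : Fin n → Fin n → Prop}
    [IsPreorder (Fin n) ρ] {P : structuralMatrixAlgebra ρ}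
    (hP : P ∈ Subalgebra.center ℂ (structuralMatrixAlgebra ρ)) :
    (P : Matrix (Fin n) (Fin n) ℂ)ᵀ = P := by
  have hoff : ∀ i j, i ≠ j → (P : Matrix (Fin n) (Fin n) ℂ) i j = 0 := by
    intro i j hij
    have h := congrArg (fun X : structuralMatrixAlgebra ρ => (X : Matrix (Fin n) (Fin n) ℂ) i j)
      (Subalgebra.mem_center_iff.mp hP ⟨_, single_mem_structuralMatrixAlgebra (refl_of ρ i) 1⟩)
    simpa [hij.symm, hij] using h
  ext i j
  rw [transpose_apply]
  by_cases hij : i = j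
  · rw [hij]
  · rw [hoff i j hij, hoff j i (Ne.symm hij)]

open Matrix in
theorem exists_eq_conj_of_rank_preserver {n : ℕ} {ρ : Fin n → Fin n → Prop}
    [IsPreorder (Fin n) ρ] {φ : structuralMatrixAlgebra ρ → Matrix (Fin n) (Fin n) ℂ}
    (hlin : IsLinearMap ℂ φ) (h1 : φ 1 = 1) (hr : IsRankPreserver φ) :
    ∃ (T : (Matrix (Fin n) (Fin n) ℂ)ˣ) (P : structuralMatrixAlgebra ρ),
      P ∈ Subalgebra.center ℂ (structuralMatrixAlgebra ρ) ∧ IsIdempotentElem P ∧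
      ∀ X : structuralMatrixAlgebra ρ,
        φ X = (T : Matrix (Fin n) (Fin n) ℂ) *
          ((P : Matrix (Fin n) (Fin n) ℂ) * (X : Matrix (Fin n) (Fin n) ℂ) +
            (1 - (P : Matrix (Fin n) (Fin n) ℂ)) *
              (X : Matrix (Fin n) (Fin n) ℂ).transpose) *
          ((T⁻¹ : (Matrix (Fin n) (Fin n) ℂ)ˣ) : Matrix (Fin n) (Fin n) ℂ) := by
  -- The extension to all matrices is arbitrary; rank preservation is used only on matrices
  -- supported in `ρ`.
  obtain ⟨f, hf⟩ := LinearMap.exists_extend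
    (p := Subalgebra.toSubmodule (structuralMatrixAlgebra ρ)) (hlin.mk' φ)
  have hfφ : ∀ X : structuralMatrixAlgebra ρ, f X = φ X := fun X => LinearMap.congr_fun hf X
  have hfr : ∀ X : Matrix (Fin n) (Fin n) ℂ, (∀ i j, X i j ≠ 0 → ρ i j) →
      (f X).rank = X.rank := fun X hX => by
    have := hr ⟨X, hX⟩
    rwa [← hfφ] at this
  have hsum : ∑ i, f (single i i 1) = 1 := by
    rw [← map_sum, sum_single_eq_diagonal, diagonal_one]
    exact (hfφ 1).trans h1
  obtain ⟨U, hU⟩ := exists_conj_eq_single_of_sum_eq_one (fun i => f (single i i 1)) (fun i => by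
    rw [hfr _ (single_mem_structuralMatrixAlgebra (refl_of ρ i) 1), single_eq_single_vecMulVec_single]
    exact rank_vecMulVec_le _ _) hsum
  let F : Matrix (Fin n) (Fin n) ℂ →ₗ[ℂ] Matrix (Fin n) (Fin n) ℂ :=
    LinearMap.mulRight ℂ (U : Matrix (Fin n) (Fin n) ℂ) ∘ₗ
      LinearMap.mulLeft ℂ ((U⁻¹ : (Matrix (Fin n) (Fin n) ℂ)ˣ) : Matrix (Fin n) (Fin n) ℂ) ∘ₗ f
  have hF : ∀ X, F X = ((U⁻¹ : (Matrix (Fin n) (Fin n) ℂ)ˣ) : Matrix (Fin n) (Fin n) ℂ) * f X *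
      (U : Matrix (Fin n) (Fin n) ℂ) := fun X => rfl
  have hFr : ∀ X : Matrix (Fin n) (Fin n) ℂ, (∀ i j, X i j ≠ 0 → ρ i j) →
      (F X).rank = X.rank := fun X hX => by
    rw [hF, rank_mul_eq_left_of_isUnit_det _ _ ((isUnit_iff_isUnit_det _).mp U.isUnit),
      rank_mul_eq_right_of_isUnit_det _ _ ((isUnit_iff_isUnit_det _).mp U⁻¹.isUnit), hfr X hX]
  obtain ⟨D, P, hP, hPP, hD⟩ := exists_eq_conj_partialTranspose hFr hU
  refine ⟨U * D, ⟨diagonal P, diagonal_mem_structuralMatrixAlgebra P⟩, ?_, ?_, fun X => ?_⟩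
  · rw [Subalgebra.mem_center_iff]
    exact fun X => Subtype.ext (diagonal_mul_comm_of_rel hP X.2).symm
  · refine Subtype.ext ?_
    change diagonal P * diagonal P = diagonal P
    rw [diagonal_mul_diagonal]
    simp only [hPP]
  · have h := hD X X.2
    rw [hF, hfφ] at h
    have h' : φ X = (U : Matrix (Fin n) (Fin n) ℂ) *
        (((U⁻¹ : (Matrix (Fin n) (Fin n) ℂ)ˣ) : Matrix (Fin n) (Fin n) ℂ) * φ X *
          (U : Matrix (Fin n) (Fin n) ℂ)) *
        ((U⁻¹ : (Matrix (Fin n) (Fin n) ℂ)ˣ) : Matrix (Fin n) (Fin n) ℂ) := by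
      simp [mul_assoc]
    rw [h', h, _root_.mul_inv_rev, Units.val_mul, Units.val_mul]
    simp only [mul_assoc]

theorem mainTheorem1 (n : ℕ) (ρ : Fin n → Fin n → Prop) [IsPreorder (Fin n) ρ] :
    (∀ φ : structuralMatrixAlgebra ρ → Matrix (Fin n) (Fin n) ℂ,
      (IsLinearMap ℂ φ ∧ φ 1 = 1 ∧ IsRankPreserver φ) ↔
        ∃ (T : (Matrix (Fin n) (Fin n) ℂ)ˣ) (P : structuralMatrixAlgebra ρ),
          P ∈ Subalgebra.center ℂ (structuralMatrixAlgebra ρ) ∧ IsIdempotentElem P ∧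
          ∀ X : structuralMatrixAlgebra ρ,
            φ X = (T : Matrix (Fin n) (Fin n) ℂ) *
              ((P : Matrix (Fin n) (Fin n) ℂ) * (X : Matrix (Fin n) (Fin n) ℂ) +
                (1 - (P : Matrix (Fin n) (Fin n) ℂ)) *
                  (X : Matrix (Fin n) (Fin n) ℂ).transpose) *
              ((T⁻¹ : (Matrix (Fin n) (Fin n) ℂ)ˣ) : Matrix (Fin n) (Fin n) ℂ)) ∧
    (∀ (g : {p : Fin n × Fin n // ρ p.1 p.2} → ℂˣ) (hg : IsTransitiveMap g),
      IsRankPreserver (fun X => (inducedAut g hg X : Matrix (Fin n) (Fin n) ℂ)) →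
        IsTrivialMap g) := by
  refine ⟨fun φ => ⟨fun ⟨hlin, h1, hr⟩ => exists_eq_conj_of_rank_preserver hlin h1 hr, ?_⟩, ?_⟩
  · rintro ⟨T, P, hPc, hPi, hφ⟩
    refine ⟨⟨fun X Y => ?_, fun c X => ?_⟩, ?_, fun X => ?_⟩
    · simp only [hφ, Subalgebra.coe_add, Matrix.transpose_add, mul_add, add_mul]
      abel
    · simp only [hφ, Subalgebra.coe_smul, Matrix.transpose_smul, Matrix.mul_smul, ← smul_add,
        Matrix.smul_mul]
    · simp [hφ]
    · rw [hφ, Matrix.rank_mul_eq_left_of_isUnit_det _ _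
          ((Matrix.isUnit_iff_isUnit_det _).mp T⁻¹.isUnit),
        Matrix.rank_mul_eq_right_of_isUnit_det _ _
          ((Matrix.isUnit_iff_isUnit_det _).mp T.isUnit)]
      exact Matrix.rank_partialTranspose (congrArg Subtype.val hPi)
        (transpose_eq_self_of_mem_center hPc)
        (congrArg Subtype.val (Subalgebra.mem_center_iff.mp hPc X)).symm
  · classical
    intro g hg hr
    -- The default value `1` outside `ρ` is immaterial, since it only multiplies zero entries.
    obtain ⟨a, b, hab⟩ := exists_eq_mul_of_rank_preserving ρ
      (fun i j => if h : ρ i j then g ⟨(i, j), h⟩ else 1) fun X hX => by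
        rw [← hr ⟨X, hX⟩]
        congr 1
        ext i j
        change _ = scaleEntries g X i j
        by_cases h : ρ i j
        · simp [scaleEntries_apply_of_rel _ _ h, h]
        · have h0 : X i j = 0 := by_contra fun h' => h (hX i j h')
          simp [scaleEntries_apply_of_not_rel _ _ h, h0]
    refine ⟨a, fun i j hij => ?_⟩
    have h1 := hab i j hij
    -- Transitivity gives `g (j, j) = 1`, hence `b j = (a j)⁻¹`.
    have h2 := hab j j (refl_of ρ j)
    simp only [hij, refl_of ρ j, dif_pos, hg.apply_diag] at h1 h2
    rw [h1, div_eq_mul_inv, eq_inv_of_mul_eq_one_right h2.symm]
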